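/- Let $\alpha\in(0,1)$ be irrational, let $1<p<\infty$, and let $L^p[0,1)$ be the complex Banach space of $p$-integrable functions with respect to Lebesgue measure on $[0,1)$. Let $T_\alpha$ be the Bishop operator on $L^p[0,1)$, $T_\alpha f(t)=t\,f(\{t+\alpha\})$, where $\{\cdot\}$ denotes the fractional part, and let $T_\alpha^*$, acting on $L^p[0,1)$, be the adjoint of the Bishop operator on $L^{p'}[0,1)$, $\frac1p+\frac1{p'}=1$, under the pairing $(f,g)\mapsto\int_0^1 f g\,dt$, that is, $T_\alpha^* f(t)=\{t-\alpha\}\,f(\{t-\alpha\})$. For a bounded linear operator $T$ on a complex Banach space $X$, let - $T^\infty(X)=\bigcap_{n\ge 1}T^n(X)$ be its hyperrange; - $C(T)$ be its algebraic core, the greatest linear submanifold $M\subseteq X$ such that $T(M)=M$; - $K(T)$ be its analytical core, the set of all $x\in X$ for which there are a sequence $(x_n)_{n\ge 0}$ in $X$ and a constant $\delta>0$ such that $x_0=x$, and $Tx_{n+1}=x_n$ and $\|x_n\|\le\delta^n\|x\|$ for every $n\ge 0$. (A linear submanifold is a vector subspace, not necessarily closed.) Then each of $K(T_\alpha)$,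 $C(T_\alpha)$ and $T_\alpha^\infty(L^p[0,1))$ is a dense, non-closed linear submanifold of $L^p[0,1)$. The same holds for $K(T_\alpha^*)$, $C(T_\alpha^*)$ and $(T_\alpha^*)^\infty(L^p[0,1))$. -/

import Mathlib

open MeasureTheory Set
open scoped ENNReal

noncomputable section

namespace Bishop

/-! ### General bounded operators on a complex Banach space -/

section General

variable {X : Type*} [NormedAddCommGroup X] [NormedSpace ℂ X]

/-- The hyperrange `T^∞(X) = ⋂_{n ≥ 1} T^n(X)`. -/
def hyperrange (T : X →L[ℂ] X) : Set X :=
  ⋂ n : ℕ, ⋂ _ : 1 ≤ n, range (T ^ n : X →L[ℂ] X)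

/-- The algebraic core `C(T)`: the greatest linear submanifold `M` with `T(M) = M`. It is
written as the supremum of all such `M`; `isGreatest_algebraicCore` shows that this supremum is
itself such an `M`. -/
def algebraicCore (T : X →L[ℂ] X) : Submodule ℂ X :=
  sSup {M : Submodule ℂ X | M.map (T : X →ₗ[ℂ] X) = M}

theorem isGreatest_algebraicCore (T : X →L[ℂ] X) :
    IsGreatest {M : Submodule ℂ X | M.map (T : X →ₗ[ℂ] X) = M} (algebraicCore T) := by
  refine ⟨?_, fun M hM => le_sSup hM⟩
  change (sSup {M : Submodule ℂ X | M.map (T : X →ₗ[ℂ] X) = M}).map (T : X →ₗ[ℂ] X) =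
    algebraicCore T
  rw [(Submodule.gc_map_comap (T : X →ₗ[ℂ] X)).l_sSup, algebraicCore, sSup_eq_iSup]
  exact iSup_congr fun M => iSup_congr fun hM => hM

/-- The analytical core `K(T)`: all `x` that admit a chain `x = x₀`, `T xₙ₊₁ = xₙ` of backward
iterates with `‖xₙ‖ ≤ δⁿ ‖x‖` for some constant `δ > 0`. -/
def analyticalCore (T : X →L[ℂ] X) : Set X :=
  {x | ∃ (u : ℕ → X) (δ : ℝ), 0 < δ ∧ u 0 = x ∧ (∀ n, T (u (n + 1)) = u n) ∧
    ∀ n, ‖u n‖ ≤ δ ^ n * ‖x‖}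

/-- `S` is a linear submanifold (a vector subspace, not assumed closed), is dense, and is not
closed. -/
def IsNonclosedDenseSubmanifold (S : Set X) : Prop :=
  (∃ M : Submodule ℂ X, (M : Set X) = S) ∧ Dense S ∧ ¬ IsClosed S

end General

/-! ### The operators on `L^p[0,1)` -/

/-- Lebesgue measure on `[0,1)`. -/
def μ01 : Measure ℝ := volume.restrict (Ico (0 : ℝ) 1)

/-- The complex Banach space `L^p[0,1)`. -/
abbrev L (p : ℝ≥0∞) : Type := Lp ℂ p μ01

/-- `t ↦ {t + a}` preserves Lebesgue measure on `[0,1)`. -/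
theorem measurePreserving_fract_add (a : ℝ) :
    MeasurePreserving (fun t : ℝ => Int.fract (t + a)) μ01 μ01 := by
  have hπ : MeasurePreserving (fun t : ℝ => (t : UnitAddCircle)) μ01 volume := by
    have h := UnitAddCircle.measurePreserving_mk 0
    rwa [zero_add, ← restrict_Ico_eq_restrict_Ioc] at h
  set s : UnitAddCircle → ℝ := fun y => (AddCircle.equivIco (1 : ℝ) 0 y : ℝ) with hs
  have hsπ : ∀ t : ℝ, s (t : UnitAddCircle) = Int.fract t := by
    intro t
    simp [hs, AddCircle.coe_equivIco_mk_apply]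
  have hsm : Measurable s :=
    measurable_subtype_coe.comp (AddCircle.measurableEquivIco (1 : ℝ) 0).measurable
  have hsp : MeasurePreserving s volume μ01 := by
    refine ⟨hsm, ?_⟩
    rw [← hπ.map_eq, Measure.map_map hsm hπ.measurable]
    have h : (s ∘ fun t : ℝ => (t : UnitAddCircle)) =ᵐ[μ01] id := by
      filter_upwards [ae_restrict_mem (measurableSet_Ico : MeasurableSet (Ico (0 : ℝ) 1))]
        with t ht
      simp only [Function.comp_apply, hsπ, id]
      exact Int.fract_eq_self.2 ⟨ht.1, ht.2⟩
    rw [Measure.map_congr h, Measure.map_id]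
  have hadd : MeasurePreserving (fun y : UnitAddCircle => y + (a : UnitAddCircle))
      volume volume := measurePreserving_add_right _ _
  have h := (hsp.comp hadd).comp hπ
  have he : ((s ∘ fun y : UnitAddCircle => y + (a : UnitAddCircle)) ∘
      fun t : ℝ => (t : UnitAddCircle)) = fun t : ℝ => Int.fract (t + a) := by
    funext t
    simp only [Function.comp_apply, ← AddCircle.coe_add, hsπ]
  rwa [he] at h

/-- The product of a function bounded by `1` on `[0,1)` and a translate of an `L^p` function. -/
theorem memLp_weighted {p : ℝ≥0∞} (w : ℝ → ℝ) (hw : Measurable w)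
    (hb : ∀ t ∈ Ico (0 : ℝ) 1, |w t| ≤ 1) (a : ℝ) (f : L p) :
    MemLp (fun t : ℝ => (w t : ℂ) * f (Int.fract (t + a))) p μ01 := by
  have hf : MemLp (fun t : ℝ => f (Int.fract (t + a))) p μ01 :=
    (Lp.memLp f).comp_measurePreserving (measurePreserving_fract_add a)
  refine hf.of_le ?_ ?_
  · exact (Complex.measurable_ofReal.comp hw).aestronglyMeasurable.mul hf.aestronglyMeasurable
  · filter_upwards [ae_restrict_mem (measurableSet_Ico : MeasurableSet (Ico (0 : ℝ) 1))]
      with t ht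
    rw [norm_mul, Complex.norm_real, Real.norm_eq_abs]
    exact mul_le_of_le_one_left (norm_nonneg _) (hb t ht)

/-- The weighted translation `f ↦ w(t) f({t + a})` on `L^p[0,1)`, for a measurable weight with
`|w| ≤ 1` on `[0,1)`. -/
def weightedTranslation (p : ℝ≥0∞) [Fact (1 ≤ p)] (w : ℝ → ℝ) (hw : Measurable w)
    (hb : ∀ t ∈ Ico (0 : ℝ) 1, |w t| ≤ 1) (a : ℝ) : L p →L[ℂ] L p :=
  LinearMap.mkContinuous
    { toFun := fun f => (memLp_weighted w hw hb a f).toLp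
        (fun t : ℝ => (w t : ℂ) * f (Int.fract (t + a)))
      map_add' := fun f g => by
        rw [← MemLp.toLp_add, MemLp.toLp_eq_toLp_iff]
        have h := (measurePreserving_fract_add a).quasiMeasurePreserving.ae (Lp.coeFn_add f g)
        filter_upwards [h] with t ht
        simp only [Pi.add_apply] at ht ⊢
        rw [ht, mul_add]
      map_smul' := fun c f => by
        rw [RingHom.id_apply, ← MemLp.toLp_const_smul, MemLp.toLp_eq_toLp_iff]
        have h := (measurePreserving_fract_add a).quasiMeasurePreserving.ae (Lp.coeFn_smul c f)
        filter_upwards [h] with t ht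
        simp only [Pi.smul_apply, smul_eq_mul] at ht ⊢
        rw [ht, mul_left_comm] }
    1
    (fun f => by
      rw [one_mul, LinearMap.coe_mk, AddHom.coe_mk, Lp.norm_toLp, Lp.norm_def]
      refine ENNReal.toReal_mono (Lp.eLpNorm_ne_top f) ?_
      calc eLpNorm (fun t : ℝ => (w t : ℂ) * f (Int.fract (t + a))) p μ01
          ≤ eLpNorm (fun t : ℝ => f (Int.fract (t + a))) p μ01 := by
            refine eLpNorm_mono_ae ?_
            filter_upwards [ae_restrict_mem
              (measurableSet_Ico : MeasurableSet (Ico (0 : ℝ) 1))] with t ht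
            rw [norm_mul, Complex.norm_real, Real.norm_eq_abs]
            exact mul_le_of_le_one_left (norm_nonneg _) (hb t ht)
        _ = eLpNorm f p μ01 :=
            eLpNorm_comp_measurePreserving (Lp.aestronglyMeasurable f)
              (measurePreserving_fract_add a))

theorem weightedTranslation_ae (p : ℝ≥0∞) [Fact (1 ≤ p)] (w : ℝ → ℝ) (hw : Measurable w)
    (hb : ∀ t ∈ Ico (0 : ℝ) 1, |w t| ≤ 1) (a : ℝ) (f : L p) :
    weightedTranslation p w hw hb a f =ᵐ[μ01]
      fun t : ℝ => (w t : ℂ) * f (Int.fract (t + a)) :=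
  MemLp.coeFn_toLp (memLp_weighted w hw hb a f)

/-- The Bishop operator `T_α f(t) = t f({t + α})` on `L^p[0,1)`. -/
def bishop (p : ℝ≥0∞) [Fact (1 ≤ p)] (α : ℝ) : L p →L[ℂ] L p :=
  weightedTranslation p (fun t => t) measurable_id
    (fun t ht => abs_le.2 ⟨by linarith [ht.1], ht.2.le⟩) α

/-- The adjoint `T_α^* f(t) = {t - α} f({t - α})`, as an operator on `L^p[0,1)`. See
`integral_bishop_mul` for the duality with the Bishop operator on `L^q[0,1)`. -/
def bishopAdjoint (p : ℝ≥0∞) [Fact (1 ≤ p)] (α : ℝ) : L p →L[ℂ] L p :=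
  weightedTranslation p (fun t => Int.fract (t + -α)) (measurable_fract.comp (measurable_add_const _))
    (fun t _ => abs_le.2 ⟨by linarith [Int.fract_nonneg (t + -α)], (Int.fract_lt_one _).le⟩) (-α)

theorem bishop_ae (p : ℝ≥0∞) [Fact (1 ≤ p)] (α : ℝ) (f : L p) :
    bishop p α f =ᵐ[μ01] fun t : ℝ => (t : ℂ) * f (Int.fract (t + α)) :=
  weightedTranslation_ae p _ _ _ α f

theorem bishopAdjoint_ae (p : ℝ≥0∞) [Fact (1 ≤ p)] (α : ℝ) (f : L p) :
    bishopAdjoint p α f =ᵐ[μ01]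
      fun t : ℝ => ((Int.fract (t - α) : ℝ) : ℂ) * f (Int.fract (t - α)) :=
  weightedTranslation_ae p _ _ _ (-α) f

/-- `bishopAdjoint p α` is the Banach space adjoint of the Bishop operator on `L^q[0,1)`, when the
dual of `L^q[0,1)` is identified with `L^p[0,1)` through `(f, g) ↦ ∫ f g`, `1/p + 1/q = 1`. -/
theorem integral_bishop_mul (p q : ℝ≥0∞) [Fact (1 ≤ p)] [Fact (1 ≤ q)] [ENNReal.HolderConjugate p q]
    (α : ℝ) (f : L q) (g : L p) :
    ∫ t, bishop q α f t * g t ∂μ01 = ∫ t, f t * bishopAdjoint p α g t ∂μ01 := by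
  set h : ℝ → ℂ := fun t => f t * (((Int.fract (t - α) : ℝ) : ℂ) * g (Int.fract (t - α))) with hh
  have hτ := measurePreserving_fract_add α
  have hm : AEStronglyMeasurable h μ01 := by
    refine (Lp.aestronglyMeasurable f).mul ?_
    exact ((Lp.aestronglyMeasurable (bishopAdjoint p α g)).congr (bishopAdjoint_ae p α g))
  have h1 : ∫ t, f t * bishopAdjoint p α g t ∂μ01 = ∫ t, h t ∂μ01 := by
    refine integral_congr_ae ?_
    filter_upwards [bishopAdjoint_ae p α g] with t ht
    rw [ht]
  have h2 : ∫ t, h t ∂μ01 = ∫ t, h (Int.fract (t + α)) ∂μ01 := by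
    have hm' : AEStronglyMeasurable h (Measure.map (fun t : ℝ => Int.fract (t + α)) μ01) := by
      rwa [hτ.map_eq]
    have h3 := integral_map hτ.measurable.aemeasurable hm'
    rwa [hτ.map_eq] at h3
  rw [h1, h2]
  refine integral_congr_ae ?_
  filter_upwards [bishop_ae q α f,
    ae_restrict_mem (measurableSet_Ico : MeasurableSet (Ico (0 : ℝ) 1))] with t ht htI
  have e : Int.fract (Int.fract (t + α) - α) = t := by
    rw [Int.fract_eq_iff]
    refine ⟨htI.1, htI.2, -⌊t + α⌋, ?_⟩
    rw [Int.fract]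
    push_cast
    ring
  rw [ht, hh]
  simp only [e]
  ring

end Bishop

end

/-! Since `K(T) ⊆ C(T) ⊆ T^∞(X) ⊆ range T`, it is enough that `K(T)` is dense and `T` is not onto: a
closed dense subspace inside the range would make the range everything. Both operators have the form
`f ↦ w · (f ∘ σ)`, with `σ` a rotation and `|w| ≤ 1`. Not onto: a preimage of `1` would give `f ∘ σ
= 1/w`, which is not integrable. Dense: formally, the `n`-th backward iterate of `F` is `F` divided
by the product of `w` along `n` orbit points, transported by `σ⁻ⁿ`. If `F` lives where these
products stay above `exp (-k n)`, the iterates grow at most like `exp (k n)` and `F ∈ K(T)`. As `log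
|w|` is integrable, the maximal ergodic inequality bounds the measure of the remaining points by
`‖log |w|‖₁ / k`, so cutting `f` off there approximates it as `k → ∞`. -/

/-! ### The maximal ergodic inequality -/

section MaximalErgodic

variable {X : Type*}

/-- The maximum of the Birkhoff sums of `g` of length at most `n`, the empty sum included. -/
noncomputable def maxBirkhoffSum (σ : X → X) (g : X → ℝ) : ℕ → X → ℝ
  | 0 => fun _ => 0
  | n + 1 => fun x => max 0 (g x + maxBirkhoffSum σ g n (σ x))

theorem maxBirkhoffSum_nonneg (σ : X → X) (g : X → ℝ) (n : ℕ) (x : X) :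
    0 ≤ maxBirkhoffSum σ g n x := by
  cases n with
  | zero => exact le_rfl
  | succ n => exact le_max_left _ _

theorem maxBirkhoffSum_le_succ (σ : X → X) (g : X → ℝ) (n : ℕ) (x : X) :
    maxBirkhoffSum σ g n x ≤ maxBirkhoffSum σ g (n + 1) x := by
  induction n generalizing x with
  | zero => exact le_max_left _ _
  | succ n ih => exact max_le_max le_rfl (add_le_add le_rfl (ih (σ x)))

theorem birkhoffSum_le_maxBirkhoffSum (σ : X → X) (g : X → ℝ) (n : ℕ) (x : X) :
    birkhoffSum σ g n x ≤ maxBirkhoffSum σ g n x := by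
  induction n generalizing x with
  | zero => simp [maxBirkhoffSum]
  | succ n ih =>
    rw [birkhoffSum_succ']
    exact (add_le_add le_rfl (ih (σ x))).trans (le_max_right _ _)

/-- Where positive, the outer maximum in the recursion is attained by its second argument;
monotonicity in `n` then restores the same index on both sides. -/
theorem maxBirkhoffSum_le_of_pos (σ : X → X) (g : X → ℝ) (n : ℕ) (x : X)
    (hx : 0 < maxBirkhoffSum σ g n x) :
    maxBirkhoffSum σ g n x ≤ g x + maxBirkhoffSum σ g n (σ x) := by
  cases n with
  | zero => exact absurd hx (lt_irrefl _)
  | succ n =>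
    have h : maxBirkhoffSum σ g (n + 1) x = g x + maxBirkhoffSum σ g n (σ x) := by
      rcases max_choice 0 (g x + maxBirkhoffSum σ g n (σ x)) with h | h
      · exact absurd hx (not_lt.2 h.le)
      · exact h
    rw [h]
    exact add_le_add le_rfl (maxBirkhoffSum_le_succ σ g n (σ x))

variable [MeasurableSpace X] {μ : Measure X} {σ : X → X} {g : X → ℝ}

theorem measurable_maxBirkhoffSum (hσ : Measurable σ) (hg : Measurable g) (n : ℕ) :
    Measurable (maxBirkhoffSum σ g n) := by
  induction n with
  | zero => exact measurable_const
  | succ n ih => exact measurable_const.max (hg.add (ih.comp hσ))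

theorem integrable_maxBirkhoffSum (hσ : MeasurePreserving σ μ μ) (hg : Integrable g μ) (n : ℕ) :
    Integrable (maxBirkhoffSum σ g n) μ := by
  induction n with
  | zero => exact integrable_zero _ _ _
  | succ n ih =>
    exact (integrable_zero _ _ _).sup (hg.add (hσ.integrable_comp_of_integrable ih))

/-- The maximal ergodic theorem. -/
theorem setIntegral_maxBirkhoffSum_pos_nonneg (hσ : MeasurePreserving σ μ μ) (hgm : Measurable g)
    (hg : Integrable g μ) (n : ℕ) :
    0 ≤ ∫ x in {x | 0 < maxBirkhoffSum σ g n x}, g x ∂μ := by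
  set M := maxBirkhoffSum σ g n with hM
  have hMm : Measurable M := measurable_maxBirkhoffSum hσ.measurable hgm n
  have hMi : Integrable M μ := integrable_maxBirkhoffSum hσ hg n
  have hMσ : Integrable (fun x => M (σ x)) μ := hσ.integrable_comp_of_integrable hMi
  have hA : MeasurableSet {x | 0 < M x} := measurableSet_lt measurable_const hMm
  -- Garsia's argument: on `{M > 0}`, `M - M ∘ σ ≤ g`. The integral of `M` there is its full
  -- integral, that of `M ∘ σ` is at most its full integral, and the two full integrals agree by
  -- invariance.
  have h1 : ∫ x in {x | 0 < M x}, (M x - M (σ x)) ∂μ ≤ ∫ x in {x | 0 < M x}, g x ∂μ := by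
    refine setIntegral_mono_on (hMi.sub hMσ).integrableOn hg.integrableOn hA fun x hx => ?_
    have := maxBirkhoffSum_le_of_pos σ g n x hx
    linarith
  have h2 : ∫ x in {x | 0 < M x}, M x ∂μ = ∫ x, M x ∂μ := by
    refine setIntegral_eq_integral_of_forall_compl_eq_zero fun x hx => ?_
    exact le_antisymm (not_lt.1 hx) (maxBirkhoffSum_nonneg σ g n x)
  have h3 : ∫ x in {x | 0 < M x}, M (σ x) ∂μ ≤ ∫ x, M (σ x) ∂μ :=
    setIntegral_le_integral hMσ
      (Filter.Eventually.of_forall fun x => maxBirkhoffSum_nonneg σ g n (σ x))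
  have h4 : ∫ x, M (σ x) ∂μ = ∫ x, M x ∂μ := by
    have hm : AEStronglyMeasurable M (Measure.map σ μ) := hMm.aestronglyMeasurable
    have h := integral_map hσ.measurable.aemeasurable hm
    rw [hσ.map_eq] at h
    exact h.symm
  rw [integral_sub hMi.integrableOn hMσ.integrableOn] at h1
  linarith

/-- The weak type `(1, 1)` inequality for the ergodic maximal function. -/
theorem measure_exists_birkhoffSum_gt_le [IsFiniteMeasure μ] (hσ : MeasurePreserving σ μ μ)
    {h : X → ℝ} (hm : Measurable h) (hi : Integrable h μ) (h0 : 0 ≤ᵐ[μ] h) {c : ℝ} (hc : 0 < c) :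
    μ {x | ∃ n : ℕ, c * n < birkhoffSum σ h n x} ≤ ENNReal.ofReal ((∫ x, h x ∂μ) / c) := by
  -- Subtracting `c` turns an average above `c` into a positive Birkhoff sum.
  set g : X → ℝ := fun x => h x - c with hg
  have hgm : Measurable g := hm.sub_const c
  have hgi : Integrable g μ := hi.sub (integrable_const c)
  have hsub : {x | ∃ n : ℕ, c * n < birkhoffSum σ h n x} ⊆
      ⋃ n, {x | 0 < maxBirkhoffSum σ g n x} := by
    rintro x ⟨n, hn⟩
    refine mem_iUnion.2 ⟨n, lt_of_lt_of_le ?_ (birkhoffSum_le_maxBirkhoffSum σ g n x)⟩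
    have : birkhoffSum σ g n x = birkhoffSum σ h n x - c * n := by
      simp [birkhoffSum, hg, Finset.sum_sub_distrib, mul_comm]
    linarith
  have hmono : Monotone fun n => {x | 0 < maxBirkhoffSum σ g n x} :=
    monotone_nat_of_le_succ fun n x hx => lt_of_lt_of_le hx (maxBirkhoffSum_le_succ σ g n x)
  refine (measure_mono hsub).trans ?_
  rw [hmono.measure_iUnion]
  refine iSup_le fun n => ?_
  have h1 := setIntegral_maxBirkhoffSum_pos_nonneg hσ hgm hgi n
  rw [integral_sub hi.integrableOn (integrable_const c).integrableOn, setIntegral_const,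
    smul_eq_mul] at h1
  have h2 := setIntegral_le_integral (s := {x | 0 < maxBirkhoffSum σ g n x}) hi h0
  rw [← ofReal_measureReal]
  refine ENNReal.ofReal_le_ofReal ?_
  rw [le_div_iff₀ hc]
  linarith

end MaximalErgodic

namespace Bishop

/-! ### Relations between the cores and the hyperrange -/

section Cores

variable {X : Type*} [NormedAddCommGroup X] [NormedSpace ℂ X]

/-- A prefactor `C` can be absorbed into the growth rate: `m ≤ m ^ n` for `m, n ≥ 1`, while at `n =
0` the required bound is an equality. For `x = 0` the zero chain serves. -/
theorem mem_analyticalCore_of_bound (T : X →L[ℂ] X) {x : X} (u : ℕ → X) (C δ : ℝ) (hδ : 0 < δ)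
    (h0 : u 0 = x) (hu : ∀ n, T (u (n + 1)) = u n) (hb : ∀ n, ‖u n‖ ≤ C * δ ^ n) :
    x ∈ analyticalCore T := by
  by_cases hx : x = 0
  · exact ⟨fun _ => 0, 1, one_pos, hx.symm, fun _ => map_zero T, fun n => by simp [hx]⟩
  have hx' : 0 < ‖x‖ := norm_pos_iff.2 hx
  set m := max 1 (C / ‖x‖) with hm
  have hm1 : 1 ≤ m := le_max_left _ _
  refine ⟨u, δ * m, by positivity, h0, hu, fun n => ?_⟩
  rcases Nat.eq_zero_or_pos n with rfl | hn
  · simp [h0]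
  have hC : C ≤ m * ‖x‖ := (div_le_iff₀ hx').1 (le_max_right _ _)
  calc ‖u n‖ ≤ C * δ ^ n := hb n
    _ ≤ m * ‖x‖ * δ ^ n := by gcongr
    _ ≤ m ^ n * ‖x‖ * δ ^ n := by
        gcongr
        exact le_self_pow₀ hm1 hn.ne'
    _ = (δ * m) ^ n * ‖x‖ := by rw [mul_pow]; ring

/-- The analytical core as a linear submanifold. -/
def analyticalCoreSubmodule (T : X →L[ℂ] X) : Submodule ℂ X where
  carrier := analyticalCore T
  zero_mem' := mem_analyticalCore_of_bound T (fun _ => 0) 0 1 one_pos rfl (by simp) (by simp)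
  add_mem' := by
    rintro x y ⟨u, δ, hδ, u0, hu, bu⟩ ⟨v, ε, hε, v0, hv, bv⟩
    refine mem_analyticalCore_of_bound T (fun n => u n + v n) (‖x‖ + ‖y‖) (max δ ε)
      (lt_max_of_lt_left hδ) (by simp [u0, v0]) (fun n => by simp [hu, hv]) fun n => ?_
    calc ‖u n + v n‖ ≤ δ ^ n * ‖x‖ + ε ^ n * ‖y‖ :=
          (norm_add_le _ _).trans (add_le_add (bu n) (bv n))
      _ ≤ (max δ ε) ^ n * ‖x‖ + (max δ ε) ^ n * ‖y‖ := by
          gcongr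
          · exact le_max_left _ _
          · exact le_max_right _ _
      _ = _ := by ring
  smul_mem' := by
    rintro c x ⟨u, δ, hδ, u0, hu, bu⟩
    refine mem_analyticalCore_of_bound T (fun n => c • u n) (‖c‖ * ‖x‖) δ hδ (by simp [u0])
      (fun n => by simp [hu]) fun n => ?_
    rw [norm_smul, mul_assoc, mul_comm ‖x‖]
    exact mul_le_mul_of_nonneg_left (bu n) (norm_nonneg c)

theorem map_analyticalCoreSubmodule (T : X →L[ℂ] X) :
    (analyticalCoreSubmodule T).map (T : X →ₗ[ℂ] X) = analyticalCoreSubmodule T := by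
  refine le_antisymm ?_ ?_
  · rintro _ ⟨x, ⟨u, δ, hδ, u0, hu, bu⟩, rfl⟩
    refine mem_analyticalCore_of_bound T (fun n => T (u n)) (‖T‖ * ‖x‖) δ hδ (by simp [u0])
      (fun n => by simp [hu]) fun n => ?_
    calc ‖T (u n)‖ ≤ ‖T‖ * (δ ^ n * ‖x‖) := T.le_opNorm_of_le (bu n)
      _ = ‖T‖ * ‖x‖ * δ ^ n := by ring
  · rintro x ⟨u, δ, hδ, u0, hu, bu⟩
    refine ⟨u 1, ?_, (hu 0).trans u0⟩
    refine mem_analyticalCore_of_bound T (fun n => u (n + 1)) (δ * ‖x‖) δ hδ rfl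
      (fun n => hu (n + 1)) fun n => (bu (n + 1)).trans_eq (by ring)

theorem analyticalCore_subset_algebraicCore (T : X →L[ℂ] X) :
    analyticalCore T ⊆ (algebraicCore T : Set X) := fun _ hx =>
  (isGreatest_algebraicCore T).2 (map_analyticalCoreSubmodule T) hx

theorem algebraicCore_subset_hyperrange (T : X →L[ℂ] X) :
    (algebraicCore T : Set X) ⊆ hyperrange T := by
  intro x hx
  refine mem_iInter₂.2 fun n _ => ?_
  -- Dropping `1 ≤ n` lets the induction start at `0`.
  clear * - hx
  induction n generalizing x with
  | zero => exact ⟨x, rfl⟩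
  | succ n ih =>
    obtain ⟨y, hy, rfl⟩ := (isGreatest_algebraicCore T).1.ge hx
    obtain ⟨z, rfl⟩ := ih hy
    exact ⟨z, by rw [pow_succ']; rfl⟩

theorem hyperrange_subset_range (T : X →L[ℂ] X) : hyperrange T ⊆ range T := fun x hx => by
  simpa using mem_iInter₂.1 hx 1 le_rfl

theorem isNonclosedDenseSubmanifold_of_subset (T : X →L[ℂ] X) (hT : ¬ Function.Surjective T)
    (hd : Dense (analyticalCore T)) (M : Submodule ℂ X) (h1 : analyticalCore T ⊆ M)
    (h2 : (M : Set X) ⊆ range T) : IsNonclosedDenseSubmanifold (M : Set X) := by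
  refine ⟨⟨M, rfl⟩, hd.mono h1, fun hc => hT ?_⟩
  rw [← range_eq_univ, ← univ_subset_iff, ← (hd.mono h1).closure_eq, hc.closure_eq]
  exact h2

theorem isNonclosedDenseSubmanifold_cores (T : X →L[ℂ] X) (hT : ¬ Function.Surjective T)
    (hd : Dense (analyticalCore T)) :
    IsNonclosedDenseSubmanifold (analyticalCore T) ∧
      IsNonclosedDenseSubmanifold (algebraicCore T : Set X) ∧
      IsNonclosedDenseSubmanifold (hyperrange T) := by
  have hC := analyticalCore_subset_algebraicCore T
  have hH := algebraicCore_subset_hyperrange T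
  have hR := hyperrange_subset_range T
  refine ⟨isNonclosedDenseSubmanifold_of_subset T hT hd (analyticalCoreSubmodule T) subset_rfl
      (hC.trans (hH.trans hR)),
    isNonclosedDenseSubmanifold_of_subset T hT hd _ hC (hH.trans hR), ?_⟩
  have he : ((⨅ n : ℕ, ⨅ _ : 1 ≤ n, LinearMap.range ((T ^ n : X →L[ℂ] X) : X →ₗ[ℂ] X) :
      Submodule ℂ X) : Set X) = hyperrange T := by
    simp only [Submodule.coe_iInf, hyperrange]
    rfl
  rw [← he] at hH hR ⊢
  exact isNonclosedDenseSubmanifold_of_subset T hT hd _ (hC.trans hH) hR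

end Cores

/-! ### Weighted translations -/

instance : IsProbabilityMeasure μ01 := ⟨by simp [μ01]⟩

theorem ae_μ01_mem : ∀ᵐ t ∂μ01, t ∈ Ico (0 : ℝ) 1 := ae_restrict_mem measurableSet_Ico

theorem fract_add_neg_fract_add (a : ℝ) {t : ℝ} (ht : t ∈ Ico (0 : ℝ) 1) :
    Int.fract (Int.fract (t + a) + -a) = t := by
  rw [Int.fract_eq_iff]
  refine ⟨ht.1, ht.2, -⌊t + a⌋, ?_⟩
  rw [Int.fract]
  push_cast
  ring

/-- The product of the weight `w` along the first `n` points of the orbit of `t` under the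
rotation by `a`. -/
noncomputable def weightProd (w : ℝ → ℝ) (a : ℝ) (n : ℕ) (t : ℝ) : ℝ :=
  ∏ j ∈ Finset.range n, w ((fun t => Int.fract (t + a))^[j] t)

theorem measurable_weightProd {w : ℝ → ℝ} (hw : Measurable w) (a : ℝ) (n : ℕ) :
    Measurable (weightProd w a n) :=
  Finset.measurable_prod _ fun j _ =>
    hw.comp ((measurePreserving_fract_add a).measurable.iterate j)

/-- The points along whose orbits the products of the weight decay at most like `exp (-k n)`. -/
def slowDecaySet (w : ℝ → ℝ) (a : ℝ) (k : ℝ) : Set ℝ :=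
  {t | ∀ n : ℕ, Real.exp (-(k * n)) ≤ |weightProd w a n t|}

theorem measurableSet_slowDecaySet {w : ℝ → ℝ} (hw : Measurable w) (a k : ℝ) :
    MeasurableSet (slowDecaySet w a k) := by
  simp only [slowDecaySet, ofPred_forall]
  exact MeasurableSet.iInter fun n =>
    measurableSet_le measurable_const (measurable_weightProd hw a n).abs

/-- The Birkhoff sums of `-log |w| ≥ 0` are minus the logarithms of the weight products, so the weak
type inequality at level `k` applies. -/
theorem measure_compl_slowDecaySet_le {w : ℝ → ℝ} (hw : Measurable w)
    (hb : ∀ t ∈ Ico (0 : ℝ) 1, |w t| ≤ 1) (hw0 : ∀ᵐ t ∂μ01, w t ≠ 0)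
    (hlog : Integrable (fun t => Real.log (w t)) μ01) (a : ℝ) {k : ℝ} (hk : 0 < k) :
    μ01 (slowDecaySet w a k)ᶜ ≤ ENNReal.ofReal ((∫ t, -Real.log (w t) ∂μ01) / k) := by
  have hσ := measurePreserving_fract_add a
  have h0 : 0 ≤ᵐ[μ01] fun t => -Real.log (w t) := by
    filter_upwards [ae_μ01_mem] with t ht
    rw [Pi.zero_apply, ← Real.log_abs]
    exact neg_nonneg.2 (Real.log_nonpos (abs_nonneg _) (hb t ht))
  refine le_trans (measure_mono_ae ?_)
    (measure_exists_birkhoffSum_gt_le hσ (Real.measurable_log.comp hw).neg hlog.neg h0 hk)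
  have hall : ∀ᵐ t ∂μ01, ∀ j : ℕ, w ((fun t => Int.fract (t + a))^[j] t) ≠ 0 :=
    ae_all_iff.2 fun j => (hσ.iterate j).quasiMeasurePreserving.ae hw0
  filter_upwards [hall] with t ht hmem
  by_contra hcon
  refine hmem fun n => ?_
  have hle : birkhoffSum (fun t => Int.fract (t + a)) (fun t => -Real.log (w t)) n t ≤ k * n :=
    not_lt.1 fun h => hcon ⟨n, h⟩
  have hne : weightProd w a n t ≠ 0 := Finset.prod_ne_zero_iff.2 fun j _ => ht j
  rw [← Real.le_log_iff_exp_le (abs_pos.2 hne), Real.log_abs, weightProd,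
    Real.log_prod fun j _ => ht j]
  simp only [birkhoffSum, Finset.sum_neg_distrib] at hle
  linarith

/-- The chain is explicit: `G n ∘ τ^[n]`, with `G n` the truncated function over the weight product
and `τ` the inverse rotation. Slow decay bounds `G n` pointwise, and `τ` preserves norms. -/
theorem toLp_indicator_mem_analyticalCore (p : ℝ≥0∞) [Fact (1 ≤ p)] {w : ℝ → ℝ}
    (hw : Measurable w) (hb : ∀ t ∈ Ico (0 : ℝ) 1, |w t| ≤ 1) (hw0 : ∀ᵐ t ∂μ01, w t ≠ 0)
    (a k : ℝ) (f : L p) (hf : MemLp ((slowDecaySet w a k).indicator f) p μ01) :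
    hf.toLp ∈ analyticalCore (weightedTranslation p w hw hb a) := by
  set σ : ℝ → ℝ := fun t => Int.fract (t + a) with hσd
  set τ : ℝ → ℝ := fun t => Int.fract (t + -a) with hτd
  have hτ : MeasurePreserving τ μ01 μ01 := measurePreserving_fract_add (-a)
  have hσ : MeasurePreserving σ μ01 μ01 := measurePreserving_fract_add a
  set F : ℝ → ℂ := (slowDecaySet w a k).indicator f with hF
  set G : ℕ → ℝ → ℂ := fun n t => ((weightProd w a n t : ℝ) : ℂ)⁻¹ * F t with hG
  have hGF : ∀ n t, ‖G n t‖ ≤ Real.exp k ^ n * ‖F t‖ := by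
    intro n t
    by_cases ht : t ∈ slowDecaySet w a k
    · rw [hG, norm_mul, norm_inv, Complex.norm_real, Real.norm_eq_abs]
      gcongr
      rw [← Real.exp_nat_mul, mul_comm, ← inv_inv (Real.exp _), ← Real.exp_neg]
      exact inv_anti₀ (Real.exp_pos _) (ht n)
    · simp [hG, hF, indicator_of_notMem ht]
  have hGm : ∀ n, AEStronglyMeasurable (G n) μ01 := fun n =>
    (Complex.measurable_ofReal.comp (measurable_weightProd hw a n)).inv.aestronglyMeasurable.mul
      hf.aestronglyMeasurable
  have hGLp : ∀ n, MemLp (G n) p μ01 := fun n =>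
    MemLp.of_le_mul hf (hGm n) (Filter.Eventually.of_forall (hGF n))
  have hGτ : ∀ n, MemLp (G n ∘ τ^[n]) p μ01 := fun n =>
    (hGLp n).comp_measurePreserving (hτ.iterate n)
  have hnorm : ∀ n, ‖(hGτ n).toLp‖ ≤ ‖hf.toLp‖ * Real.exp k ^ n := by
    intro n
    have h1 : ‖(hGτ n).toLp‖ = ‖(hGLp n).toLp‖ := by
      rw [Lp.norm_toLp, Lp.norm_toLp,
        eLpNorm_comp_measurePreserving (hGm n) (hτ.iterate n)]
    rw [h1, mul_comm]
    refine Lp.norm_le_mul_norm_of_ae_le_mul ?_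
    filter_upwards [(hGLp n).coeFn_toLp, hf.coeFn_toLp] with t h1 h2
    rw [h1, h2]
    exact hGF n t
  refine mem_analyticalCore_of_bound _ (fun n => (hGτ n).toLp) ‖hf.toLp‖ (Real.exp k)
    (Real.exp_pos k) ?_ ?_ hnorm
  · rw [MemLp.toLp_eq_toLp_iff]
    exact Filter.Eventually.of_forall fun t => by simp [hG, hF, weightProd]
  · intro n
    refine Lp.ext ?_
    filter_upwards [weightedTranslation_ae p w hw hb a (hGτ (n + 1)).toLp,
      hσ.quasiMeasurePreserving.ae (hGτ (n + 1)).coeFn_toLp, (hGτ n).coeFn_toLp, hw0,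
      ae_μ01_mem] with t h1 h2 h3 h4 ht
    have hστ : σ^[n] (τ^[n] t) = t := by
      have hmaps : ∀ m, τ^[m] t ∈ Ico (0 : ℝ) 1 := by
        intro m
        cases m with
        | zero => exact ht
        | succ m =>
          rw [Function.iterate_succ_apply']
          exact ⟨Int.fract_nonneg _, Int.fract_lt_one _⟩
      clear * - hmaps
      induction n with
      | zero => rfl
      | succ n ih =>
        rw [Function.iterate_succ_apply, Function.iterate_succ_apply']
        have := fract_add_neg_fract_add (-a) (hmaps n)
        rw [neg_neg] at this
        rw [show σ (τ (τ^[n] t)) = τ^[n] t from this, ih]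
    rw [h1, h3]
    change (w t : ℂ) * (hGτ (n + 1)).toLp _ (σ t) = _
    rw [h2, Function.comp_apply, Function.comp_apply, Function.iterate_succ_apply,
      show τ (σ t) = t from fract_add_neg_fract_add a ht]
    -- The extra factor sits at `σ^[n] (τ^[n] t) = t`, so it cancels the weight applied by the
    -- operator.
    have hprod : weightProd w a (n + 1) (τ^[n] t) = weightProd w a n (τ^[n] t) * w t := by
      rw [weightProd, Finset.prod_range_succ, ← weightProd]
      change _ * w (σ^[n] _) = _
      rw [hστ]
    have hwt : (w t : ℂ) ≠ 0 := Complex.ofReal_ne_zero.2 h4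
    simp only [hG, hprod, Complex.ofReal_mul, mul_inv_rev]
    rw [← mul_assoc, ← mul_assoc, mul_inv_cancel₀ hwt, one_mul]

theorem dense_analyticalCore_weightedTranslation (p : ℝ≥0∞) [Fact (1 ≤ p)] (hp : p ≠ ⊤)
    {w : ℝ → ℝ} (hw : Measurable w) (hb : ∀ t ∈ Ico (0 : ℝ) 1, |w t| ≤ 1)
    (hw0 : ∀ᵐ t ∂μ01, w t ≠ 0) (hlog : Integrable (fun t => Real.log (w t)) μ01) (a : ℝ) :
    Dense (analyticalCore (weightedTranslation p w hw hb a)) := by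
  intro f
  rw [Metric.mem_closure_iff]
  intro ε hε
  obtain ⟨δ, hδ, hδε⟩ := (Lp.memLp f).eLpNorm_indicator_le Fact.out hp (half_pos hε)
  set I := ∫ t, -Real.log (w t) ∂μ01 with hI
  -- `δ` comes from uniform integrability of `f`; `k` makes the discarded set have measure at most
  -- `δ`.
  obtain ⟨k, hk, hkδ⟩ : ∃ k : ℝ, 0 < k ∧ I / k ≤ δ := by
    refine ⟨max 1 (I / δ), by positivity, ?_⟩
    rw [div_le_iff₀ (by positivity), mul_comm, ← div_le_iff₀ hδ]
    exact le_max_right _ _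
  have hS := measurableSet_slowDecaySet hw a k
  have hf := (Lp.memLp f).indicator hS
  refine ⟨hf.toLp, toLp_indicator_mem_analyticalCore p hw hb hw0 a k f hf, ?_⟩
  have hle := hδε _ hS.compl ((measure_compl_slowDecaySet_le hw hb hw0 hlog a hk).trans
    (ENNReal.ofReal_le_ofReal hkδ))
  have hEq : (f - hf.toLp : L p) =ᵐ[μ01] (slowDecaySet w a k)ᶜ.indicator f := by
    filter_upwards [Lp.coeFn_sub f hf.toLp, hf.coeFn_toLp] with t h1 h2
    rw [h1, Pi.sub_apply, h2, indicator_compl, Pi.sub_apply]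
  rw [dist_eq_norm, Lp.norm_def, eLpNorm_congr_ae hEq]
  exact (ENNReal.toReal_le_of_le_ofReal (half_pos hε).le hle).trans_lt (half_lt_self hε)

/-- The constant `1` has no preimage: on a probability space `L^p ⊆ L^1`, so `1/w` would be
integrable. -/
theorem not_surjective_weightedTranslation (p : ℝ≥0∞) [hp : Fact (1 ≤ p)]
    {w : ℝ → ℝ} (hw : Measurable w) (hb : ∀ t ∈ Ico (0 : ℝ) 1, |w t| ≤ 1)
    (hinv : ¬ Integrable (fun t => (w t)⁻¹) μ01) (a : ℝ) :
    ¬ Function.Surjective (weightedTranslation p w hw hb a) := by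
  intro hT
  have h1 : MemLp (fun _ : ℝ => (1 : ℂ)) p μ01 := memLp_const 1
  obtain ⟨f, hf⟩ := hT h1.toLp
  have hfσ : Integrable (fun t => f (Int.fract (t + a))) μ01 :=
    ((Lp.memLp f).comp_measurePreserving (measurePreserving_fract_add a)).integrable hp.out
  refine hinv (hfσ.re.congr ?_)
  filter_upwards [weightedTranslation_ae p w hw hb a f, h1.coeFn_toLp] with t h2 h3
  rw [hf, h3] at h2
  rw [eq_inv_of_mul_eq_one_right h2.symm, ← Complex.ofReal_inv]
  exact Complex.ofReal_re _

theorem isNonclosedDenseSubmanifold_weightedTranslation (p : ℝ≥0∞) [Fact (1 ≤ p)] (hp : p ≠ ⊤)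
    {w : ℝ → ℝ} (hw : Measurable w) (hb : ∀ t ∈ Ico (0 : ℝ) 1, |w t| ≤ 1)
    (hw0 : ∀ᵐ t ∂μ01, w t ≠ 0) (hlog : Integrable (fun t => Real.log (w t)) μ01)
    (hinv : ¬ Integrable (fun t => (w t)⁻¹) μ01) (a : ℝ) :
    IsNonclosedDenseSubmanifold (analyticalCore (weightedTranslation p w hw hb a)) ∧
      IsNonclosedDenseSubmanifold
        (algebraicCore (weightedTranslation p w hw hb a) : Set (L p)) ∧
      IsNonclosedDenseSubmanifold (hyperrange (weightedTranslation p w hw hb a)) :=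
  isNonclosedDenseSubmanifold_cores _ (not_surjective_weightedTranslation p hw hb hinv a)
    (dense_analyticalCore_weightedTranslation p hp hw hb hw0 hlog a)

/-! ### Integrability properties of the weight `t` -/

theorem ae_μ01_ne_zero : ∀ᵐ t ∂μ01, t ≠ 0 :=
  ae_restrict_of_ae (Measure.ae_ne volume 0)

theorem integrable_log_μ01 : Integrable Real.log μ01 := by
  rw [μ01, restrict_Ico_eq_restrict_Ioc]
  exact (intervalIntegrable_iff_integrableOn_Ioc_of_le zero_le_one).1
    intervalIntegral.intervalIntegrable_log'

theorem not_integrable_inv_μ01 : ¬ Integrable (fun t : ℝ => t⁻¹) μ01 := by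
  rw [μ01, restrict_Ico_eq_restrict_Ioc]
  intro h
  have := intervalIntegrable_inv_iff.1
    ((intervalIntegrable_iff_integrableOn_Ioc_of_le zero_le_one).2 h)
  simp at this

end Bishop

theorem corollary5p5 (α : ℝ) (hα : Irrational α) (hα01 : α ∈ Set.Ioo (0 : ℝ) 1)
    (p : ENNReal) [Fact (1 ≤ p)] (hp : 1 < p) (hp' : p < ⊤) :
    (Bishop.IsNonclosedDenseSubmanifold (Bishop.analyticalCore (Bishop.bishop p α)) ∧
      Bishop.IsNonclosedDenseSubmanifold
        (Bishop.algebraicCore (Bishop.bishop p α) : Set (Bishop.L p)) ∧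
      Bishop.IsNonclosedDenseSubmanifold (Bishop.hyperrange (Bishop.bishop p α))) ∧
    (Bishop.IsNonclosedDenseSubmanifold (Bishop.analyticalCore (Bishop.bishopAdjoint p α)) ∧
      Bishop.IsNonclosedDenseSubmanifold
        (Bishop.algebraicCore (Bishop.bishopAdjoint p α) : Set (Bishop.L p)) ∧
      Bishop.IsNonclosedDenseSubmanifold (Bishop.hyperrange (Bishop.bishopAdjoint p α))) := by
  have hτ := Bishop.measurePreserving_fract_add (-α)
  refine ⟨Bishop.isNonclosedDenseSubmanifold_weightedTranslation p hp'.ne _ _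
      Bishop.ae_μ01_ne_zero Bishop.integrable_log_μ01 Bishop.not_integrable_inv_μ01 α,
    -- The adjoint's weight is `t` composed with the rotation by `-α`, so its properties transfer by
    -- measure preservation.
    Bishop.isNonclosedDenseSubmanifold_weightedTranslation p hp'.ne _ _
      (hτ.quasiMeasurePreserving.ae Bishop.ae_μ01_ne_zero)
      (hτ.integrable_comp_of_integrable Bishop.integrable_log_μ01)
      (fun h => Bishop.not_integrable_inv_μ01
        ((hτ.integrable_comp measurable_inv.aestronglyMeasurable).1 h)) (-α)⟩
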